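/- Let $\mathbf Z$ be a Prüfer domain (an integral domain in which every nonzero finitely generated ideal is invertible) of Krull dimension $\le 1$, with field of fractions $\mathbf K$. A \emph{pseudo-matrix} $(\mathfrak h_1,\dots,\mathfrak h_n;\mathfrak e_1,\dots,\mathfrak e_m;A)$ consists of invertible fractional ideals $\mathfrak h_i$ (row ideals) and $\mathfrak e_j$ (column ideals) of $\mathbf Z$ and a matrix $A=(a_{ij})\in\mathbf K^{n\times m}$ with $a_{ij}\mathfrak e_j\subseteq\mathfrak h_i$ for all $i,j$. Pseudo-matrices are multiplied by $$(\mathfrak c;\mathfrak h;B)\cdot(\mathfrak h;\mathfrak e;A)=(\mathfrak c;\mathfrak e;BA);$$ a square pseudo-matrix $(\mathfrak h;\mathfrak e;A)$ is invertible if there is a pseudo-matrix $(\mathfrak e;\mathfrak h;B)$ with $AB=BA=\mathrm I$. Two pseudo-matrices $A$, $A'$ of the same size are \emph{equivalent} if $LAC=A'$ for some invertible pseudo-matrices $L$, $C$ of suitable row and column ideals. An ordinary matrix over $\mathbf Z$ is regarded as a pseudo-matrix all of whose row and column ideals are $\langle 1\rangle$. For a matrix $M$ over $\mathbf Z$, $\mathfrak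 D_k(M)$ denotes the ideal of $\mathbf Z$ generated by the minors of order $k$ of $M$. \textbf{Theorem.} Let $M\in\mathbf M_{n,m}(\mathbf Z)$ be a matrix with $\mathfrak D_n(M)\ne 0$, and let $\delta$ be a nonzero element of $\mathfrak D_n(M)$. Then $n\le m$, and there are invertible fractional ideals $\mathfrak a_1,\dots,\mathfrak a_m$ of $\mathbf Z$ such that $M$ is equivalent to the pseudo-matrix $$M_1=(\langle1\rangle,\dots,\langle1\rangle;\ \mathfrak a_1,\dots,\mathfrak a_m;\ [\,\mathrm I_n\mid 0\,])$$ and such that $\mathfrak a_1\supseteq\mathfrak a_2\supseteq\cdots\supseteq\mathfrak a_n$, $\prod_{i=1}^n\mathfrak a_i=\mathfrak D_n(M)$, each $\mathfrak a_i$ with $1\le i\le n$ is of the form $\langle a_i,\delta\rangle$ for some $a_i\in\mathbf Z$, and $\bigoplus_{k=1}^m\mathfrak a_k\simeq\mathbf Z^m$ as $\mathbf Z$-modules. -/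

import Mathlib

open scoped nonZeroDivisors DirectSum

/-- A Prüfer domain: an integral domain in which every nonzero finitely generated ideal `I` is
invertible, that is, `I * J = ⟨c⟩` for some finitely generated ideal `J` and some `c ≠ 0`. -/
class IsPruferDomain (R : Type*) [CommRing R] : Prop extends IsDomain R where
  exists_mul_eq_span_singleton : ∀ I : Ideal R, I.FG → I ≠ ⊥ →
    ∃ J : Ideal R, J.FG ∧ ∃ c : R, c ≠ 0 ∧ I * J = Ideal.span {c}

/-- The determinantal ideal of order `k` of a matrix: the ideal generated by the minors of
order `k` (rows and columns being extracted in increasing order). -/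
def Matrix.determinantalIdeal {R : Type*} [CommRing R] {n m : ℕ} (k : ℕ)
    (M : Matrix (Fin n) (Fin m) R) : Ideal R :=
  Ideal.span (Set.range fun p : (Fin k ↪o Fin n) × (Fin k ↪o Fin m) =>
    (M.submatrix p.1 p.2).det)

/-- A pseudo-matrix with row ideals `h i` and column ideals `e j`, which are invertible
fractional ideals: a matrix `(a i j)` with entries in the field of fractions `K`
such that `a i j • e j ⊆ h i` for all `i`, `j`. -/
@[ext]
structure PseudoMatrix {R K : Type*} [CommRing R] [Field K] [Algebra R K] {ι κ : Type*}
    (h : ι → (FractionalIdeal R⁰ K)ˣ) (e : κ → (FractionalIdeal R⁰ K)ˣ) where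
  /-- The underlying matrix over the field of fractions. -/
  mat : Matrix ι κ K
  mul_mem : ∀ i j, ∀ x ∈ (e j : FractionalIdeal R⁰ K),
    mat i j * x ∈ (h i : FractionalIdeal R⁰ K)

namespace PseudoMatrix

variable {R K : Type*} [CommRing R] [Field K] [Algebra R K]

/-- An ordinary matrix, seen as a pseudo-matrix whose row and column ideals all equal `⟨1⟩`. -/
def ofMatrix {ι κ : Type*} (M : Matrix ι κ R) :
    PseudoMatrix (fun _ : ι => (1 : (FractionalIdeal R⁰ K)ˣ))
      (fun _ : κ => (1 : (FractionalIdeal R⁰ K)ˣ)) where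
  mat := M.map (algebraMap R K)
  mul_mem := by
    intro i j x hx
    rw [Units.val_one, FractionalIdeal.mem_one_iff] at hx ⊢
    obtain ⟨y, rfl⟩ := hx
    exact ⟨M i j * y, by simp⟩

/-- The product of `B = (c; h; B)` and `A = (h; e; A)` is `(c; e; B * A)`. -/
def mul {ι κ μ : Type*} [Fintype κ] {c : ι → (FractionalIdeal R⁰ K)ˣ}
    {h : κ → (FractionalIdeal R⁰ K)ˣ} {e : μ → (FractionalIdeal R⁰ K)ˣ}
    (B : PseudoMatrix c h) (A : PseudoMatrix h e) : PseudoMatrix c e where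
  mat := B.mat * A.mat
  mul_mem := by
    intro i j x hx
    rw [Matrix.mul_apply, Finset.sum_mul]
    refine Submodule.sum_mem ((c i : FractionalIdeal R⁰ K) : Submodule R K) fun k _ => ?_
    rw [mul_assoc]
    exact B.mul_mem i k _ (A.mul_mem k j x hx)

/-- The identity pseudo-matrix on a family of row (and column) ideals. -/
def one {ι : Type*} [DecidableEq ι] (e : ι → (FractionalIdeal R⁰ K)ˣ) : PseudoMatrix e e where
  mat := 1
  mul_mem := by
    intro i j x hx
    by_cases hij : i = j
    · subst hij
      simpa using hx
    · rw [Matrix.one_apply_ne hij, zero_mul]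
      exact Submodule.zero_mem ((e i : FractionalIdeal R⁰ K) : Submodule R K)

/-- A square pseudo-matrix is invertible if it has a two-sided inverse pseudo-matrix. -/
def IsInvertible {ι : Type*} [Fintype ι] [DecidableEq ι] {h e : ι → (FractionalIdeal R⁰ K)ˣ}
    (A : PseudoMatrix h e) : Prop :=
  ∃ B : PseudoMatrix e h, A.mul B = one h ∧ B.mul A = one e

/-- Two pseudo-matrices `A`, `A'` of the same format are equivalent if `L * A * C = A'` for
some invertible pseudo-matrices `L`, `C` (changes of pseudo-bases). -/
def Equivalent {ι κ : Type*} [Fintype ι] [DecidableEq ι] [Fintype κ] [DecidableEq κ]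
    {h h' : ι → (FractionalIdeal R⁰ K)ˣ} {e e' : κ → (FractionalIdeal R⁰ K)ˣ}
    (A : PseudoMatrix h e) (A' : PseudoMatrix h' e') : Prop :=
  ∃ (L : PseudoMatrix h' h) (C : PseudoMatrix e e'),
    L.IsInvertible ∧ C.IsInvertible ∧ (L.mul A).mul C = A'

end PseudoMatrix

/-!
Modulo `δ` the ring is a zero-dimensional Prüfer ring, in which divisibility is total up to an
idempotent: of two elements, each divides the other on one of two complementary factors of the ring.
Hence linear forms on a finitely generated module attain a value dividing all the others, and the
elimination that yields stacked bases over a valuation ring works for the column module `P` of `M`,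
which contains `δ • Rⁿ` by Cramer's rule: `P` is the direct sum of the `⟨aᵢ, δ⟩ • bᵢ` for some basis
`b` of `Rⁿ`, and the product of the ideals `⟨aᵢ, δ⟩` is the determinantal ideal.

Invertible ideals are projective, so `M : Rᵐ → P` splits and the vectors `bᵢ` lift to `Rᵐ ⊗ K`;
splitting off linear forms one at a time, by the same argument, decomposes the kernel into
invertible ideals. In the resulting pseudo-bases of `Rᵐ` and `Rⁿ`, the matrix of `M` is `[Iₙ | 0]`.
-/

section Divisibility

/-- Divisibility in `A` is total up to an idempotent: for all `a` and `b`, the ring splits as a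
product of two rings such that `a` divides `b` in the first factor and `b` divides `a` in the
second one. -/
def IsDvdTotalUpToIdempotent (A : Type*) [CommRing A] : Prop :=
  ∀ a b : A, ∃ e, IsIdempotentElem e ∧ a ∣ e * b ∧ b ∣ (1 - e) * a

theorem IsPruferDomain.exists_dvd_mul {R : Type*} [CommRing R] [IsPruferDomain R] (a b : R) :
    ∃ s, a ∣ s * b ∧ b ∣ (1 - s) * a := by
  by_cases hab : Ideal.span {a, b} = ⊥
  · obtain ⟨rfl, rfl⟩ : a = 0 ∧ b = 0 := by simpa [Ideal.span_eq_bot] using hab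
    exact ⟨0, by simp, by simp⟩
  obtain ⟨J, -, c, hc, hJ⟩ := IsPruferDomain.exists_mul_eq_span_singleton
    (Ideal.span {a, b}) (Submodule.fg_span (Set.toFinite _)) hab
  have ha : a ∈ Ideal.span {a, b} := Ideal.subset_span (by simp)
  have hb : b ∈ Ideal.span {a, b} := Ideal.subset_span (by simp)
  have dvd_mul_of_mem : ∀ w ∈ Ideal.span {a, b}, ∀ z ∈ J, c ∣ w * z := fun w hw z hz =>
    Ideal.mem_span_singleton.1 (hJ ▸ Ideal.mul_mem_mul hw hz)
  obtain ⟨x, hx, y, hy, hxy⟩ : ∃ x ∈ J, ∃ y ∈ J, a * x + b * y = c := by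
    have hc : c ∈ Ideal.span {a} * J ⊔ Ideal.span {b} * J := by
      rw [← Ideal.sup_mul, ← Ideal.span_insert, hJ]
      exact Ideal.mem_span_singleton_self c
    simpa only [Submodule.mem_sup, Ideal.mem_span_singleton_mul, exists_exists_and_eq_and] using hc
  obtain ⟨s, hs⟩ := dvd_mul_of_mem a ha x hx
  obtain ⟨t, ht⟩ := dvd_mul_of_mem b hb x hx
  obtain ⟨r, hr⟩ := dvd_mul_of_mem a ha y hy
  refine ⟨s, ⟨t, mul_left_cancel₀ hc ?_⟩, ⟨r, mul_left_cancel₀ hc ?_⟩⟩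
  · linear_combination (-b) * hs + a * ht
  · linear_combination (-a) * hxy + a * hs + b * hr

variable {A : Type*} [CommRing A]

theorem exists_pow_mul_one_sub_mul_eq_zero [Ring.KrullDimLE 0 A] (s : A) :
    ∃ k y, s ^ k * (1 - s * y) = 0 := by
  let S : Submonoid A :=
    { carrier := {x | ∃ k y, s ^ k * (1 - s * y) = x}
      one_mem' := ⟨0, 0, by simp⟩
      mul_mem' := by
        rintro _ _ ⟨k, y, rfl⟩ ⟨l, z, rfl⟩
        exact ⟨k + l, y + z - s * y * z, by ring⟩ }
  suffices h : (0 : A) ∈ S from h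
  by_contra h
  obtain ⟨p, hp, -, hpS⟩ := Ideal.exists_le_prime_disjoint ⊥ S (by simpa using h)
  have hs : s ∉ p := fun hs => Set.disjoint_left.1 hpS hs ⟨1, 0, by simp⟩
  obtain ⟨y, i, hi, hy⟩ := hp.isMaximal'.exists_inv hs
  have hsy : 1 - s * y ∈ p := by rwa [← hy, mul_comm y s, add_sub_cancel_left]
  exact Set.disjoint_left.1 hpS hsy ⟨0, y, by simp⟩

theorem exists_isIdempotentElem_dvd_and_one_sub_dvd [Ring.KrullDimLE 0 A] (s : A) :
    ∃ e, IsIdempotentElem e ∧ s ∣ e ∧ 1 - s ∣ 1 - e := by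
  obtain ⟨k, y, hk⟩ := exists_pow_mul_one_sub_mul_eq_zero s
  set e := (s * y) ^ (k + 1)
  have hse : s ^ k * (1 - e) = 0 :=
    zero_dvd_iff.1 (hk ▸ mul_dvd_mul_left _ (one_sub_dvd_one_sub_pow (s * y) (k + 1)))
  have he : e = s ^ k * (s * y ^ (k + 1)) := by
    simp only [e]
    ring
  refine ⟨e, ?_, (dvd_mul_right s y).trans (dvd_pow_self _ k.succ_ne_zero), ?_⟩
  · have h : e * (1 - e) = 0 := by
      nth_rw 1 [he]
      rw [mul_right_comm, hse, zero_mul]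
    exact (by linear_combination -h : e * e = e)
  · have h : 1 - e = (1 - s ^ k) * (1 - e) := by linear_combination hse
    rw [h]
    exact (one_sub_dvd_one_sub_pow s k).mul_right _

theorem isDvdTotalUpToIdempotent_quotient {R : Type*} [CommRing R] [IsPruferDomain R]
    (I : Ideal R) [Ring.KrullDimLE 0 (R ⧸ I)] : IsDvdTotalUpToIdempotent (R ⧸ I) := by
  intro a b
  obtain ⟨a, rfl⟩ := Ideal.Quotient.mk_surjective a
  obtain ⟨b, rfl⟩ := Ideal.Quotient.mk_surjective b
  obtain ⟨s, hab, hba⟩ := IsPruferDomain.exists_dvd_mul a b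
  obtain ⟨e, he, hse, hse'⟩ := exists_isIdempotentElem_dvd_and_one_sub_dvd (Ideal.Quotient.mk I s)
  refine ⟨e, he, ?_, ?_⟩
  · replace hab := map_dvd (Ideal.Quotient.mk I) hab
    rw [map_mul] at hab
    exact hab.trans (mul_dvd_mul_right hse _)
  · replace hba := map_dvd (Ideal.Quotient.mk I) hba
    rw [map_mul, map_sub, map_one] at hba
    exact hba.trans (mul_dvd_mul_right hse' _)

theorem mul_add_one_sub_mul_dvd_of_isIdempotentElem {e a b : A} (he : IsIdempotentElem e)
    (hab : a ∣ e * b) (hba : b ∣ (1 - e) * a) :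
    e * a + (1 - e) * b ∣ a ∧ e * a + (1 - e) * b ∣ b := by
  have hee : e * e = e := he
  set d := e * a + (1 - e) * b with hd
  have hda : d ∣ e * a := ⟨e, by rw [hd]; linear_combination (b - a) * hee⟩
  have hdb : d ∣ (1 - e) * b := ⟨1 - e, by rw [hd]; linear_combination (a - b) * hee⟩
  have hda' : d ∣ (1 - e) * a := hdb.trans (by
    simpa only [← mul_assoc, he.one_sub.eq] using mul_dvd_mul_left (1 - e) hba)
  have hdb' : d ∣ e * b := hda.trans (by
    simpa only [← mul_assoc, hee] using mul_dvd_mul_left e hab)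
  constructor
  · simpa only [← add_mul, add_sub_cancel, one_mul] using dvd_add hda hda'
  · simpa only [← add_mul, add_sub_cancel, one_mul] using dvd_add hdb' hdb

end Divisibility

section LinearForms

variable {R A E : Type*} [CommRing R] [CommRing A] [Algebra R A] [AddCommGroup E] [Module R E]

theorem exists_mem_forall_apply_dvd (hA : IsDvdTotalUpToIdempotent A)
    (hRA : Function.Surjective (algebraMap R A)) {Q : Submodule R E} (hQ : Q.FG)
    (f : E →ₗ[R] A) : ∃ q ∈ Q, ∀ x ∈ Q, f q ∣ f x := by
  induction Q, hQ using Submodule.fg_induction with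
  | singleton q =>
    refine ⟨q, Submodule.mem_span_singleton_self q, fun x hx => ?_⟩
    obtain ⟨c, rfl⟩ := Submodule.mem_span_singleton.1 hx
    rw [map_smul, Algebra.smul_def]
    exact dvd_mul_left _ _
  | sup Q₁ Q₂ _ _ ih₁ ih₂ =>
    obtain ⟨q₁, hq₁, H₁⟩ := ih₁
    obtain ⟨q₂, hq₂, H₂⟩ := ih₂
    obtain ⟨e, he, h₁₂, h₂₁⟩ := hA (f q₁) (f q₂)
    obtain ⟨h₁, h₂⟩ := mul_add_one_sub_mul_dvd_of_isIdempotentElem he h₁₂ h₂₁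
    obtain ⟨r, rfl⟩ := hRA e
    refine ⟨r • q₁ + (1 - r) • q₂,
      Submodule.add_mem_sup (Q₁.smul_mem _ hq₁) (Q₂.smul_mem _ hq₂), fun x hx => ?_⟩
    obtain ⟨x₁, hx₁, x₂, hx₂, rfl⟩ := Submodule.mem_sup.1 hx
    simp only [map_add, map_smul, Algebra.smul_def, map_sub, map_one]
    exact dvd_add (h₁.trans (H₁ x₁ hx₁)) (h₂.trans (H₂ x₂ hx₂))

theorem exists_smul_mem_forall_add_smul_apply_dvd (hA : IsDvdTotalUpToIdempotent A)
    (hRA : Function.Surjective (algebraMap R A)) {Q : Submodule R E} (hQ : Q.FG)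
    (f g : E →ₗ[R] A) :
    ∃ c : R, ∃ q ∈ Q, ∀ x ∈ Q, (f + c • g) q ∣ f x ∧ (f + c • g) q ∣ g x := by
  obtain ⟨q₁, hq₁, H₁⟩ := exists_mem_forall_apply_dvd hA hRA hQ f
  obtain ⟨q₂, hq₂, H₂⟩ := exists_mem_forall_apply_dvd hA hRA hQ g
  obtain ⟨e, he, h₁₂, h₂₁⟩ := hA (f q₁) (g q₂)
  obtain ⟨h₁, h₂⟩ := mul_add_one_sub_mul_dvd_of_isIdempotentElem he h₁₂ h₂₁
  obtain ⟨t, ht⟩ := H₁ q₂ hq₂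
  obtain ⟨u, hu⟩ := h₂₁
  obtain ⟨r, rfl⟩ := hRA e
  obtain ⟨c, hc⟩ := hRA ((1 - algebraMap R A r) * (1 - t * u))
  have hr : algebraMap R A r * algebraMap R A r = algebraMap R A r := he
  -- Where `r = 1` this is `c = 0` and `q = q₁`; where `r = 0` it is `q = q₂` and `c = 1 - t * u`,
  -- chosen such that `(f + c • g) q₂ = g q₂`.
  refine ⟨c, r • q₁ + (1 - r) • q₂, Q.add_mem (Q.smul_mem _ hq₁) (Q.smul_mem _ hq₂), ?_⟩
  have hval : (f + c • g) (r • q₁ + (1 - r) • q₂) =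
      algebraMap R A r * f q₁ + (1 - algebraMap R A r) * g q₂ := by
    simp only [LinearMap.add_apply, LinearMap.smul_apply, map_add, map_smul, Algebra.smul_def,
      map_sub, map_one, hc, ht]
    linear_combination (1 - algebraMap R A r) * t * hu -
      (t * f q₁ + (1 - t * u) * (g q₁ - g q₂)) * hr
  rw [hval]
  exact fun x hx => ⟨h₁.trans (H₁ x hx), h₂.trans (H₂ x hx)⟩

theorem exists_mem_forall_add_apply_dvd (hA : IsDvdTotalUpToIdempotent A)
    (hRA : Function.Surjective (algebraMap R A)) {Q : Submodule R E} (hQ : Q.FG)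
    {G : Submodule R (E →ₗ[R] A)} (hG : G.FG) (f : E →ₗ[R] A) :
    ∃ g ∈ G, ∃ q ∈ Q, ∀ x ∈ Q, (f + g) q ∣ f x ∧ ∀ g' ∈ G, (f + g) q ∣ g' x := by
  induction G, hG using Submodule.fg_induction generalizing f with
  | singleton g =>
    obtain ⟨c, q, hq, H⟩ := exists_smul_mem_forall_add_smul_apply_dvd hA hRA hQ f g
    refine ⟨c • g, Submodule.smul_mem _ c (Submodule.mem_span_singleton_self g), q, hq,
      fun x hx => ⟨(H x hx).1, fun g' hg' => ?_⟩⟩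
    obtain ⟨d, rfl⟩ := Submodule.mem_span_singleton.1 hg'
    rw [LinearMap.smul_apply, Algebra.smul_def]
    exact (H x hx).2.mul_left _
  | sup G₁ G₂ _ _ ih₁ ih₂ =>
    obtain ⟨g₁, hg₁, q₁, hq₁, H₁⟩ := ih₁ f
    obtain ⟨g₂, hg₂, q, hq, H₂⟩ := ih₂ (f + g₁)
    have hdvd : (f + g₁ + g₂) q ∣ (f + g₁) q₁ := (H₂ q₁ hq₁).1
    refine ⟨g₁ + g₂, Submodule.add_mem_sup hg₁ hg₂, q, hq, fun x hx => ?_⟩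
    rw [← add_assoc]
    refine ⟨hdvd.trans (H₁ x hx).1, fun g' hg' => ?_⟩
    obtain ⟨k₁, hk₁, k₂, hk₂, rfl⟩ := Submodule.mem_sup.1 hg'
    exact dvd_add (hdvd.trans ((H₁ x hx).2 k₁ hk₁)) ((H₂ x hx).2 k₂ hk₂)

end LinearForms

section Splitting

variable {R V W : Type*} [Ring R] [AddCommGroup V] [Module R V] [AddCommGroup W] [Module R W]

/-- The decomposition of the source of a linear map `f` with a section `g`: the component of `x`
in the kernel is `x - g (f x)`. -/
def splitKerEquiv (f : W →ₗ[R] V) (g : V →ₗ[R] W) (h : f ∘ₗ g = LinearMap.id) :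
    W ≃ₗ[R] V × LinearMap.ker f :=
  have hfg : ∀ v, f (g v) = v := LinearMap.congr_fun h
  LinearEquiv.ofLinearMap
    (f.prod ((LinearMap.id - g ∘ₗ f).codRestrict (LinearMap.ker f) fun x => by simp [hfg]))
    (g.coprod (LinearMap.ker f).subtype)
    (LinearMap.ext fun x => Prod.ext (by simp [hfg]) (Subtype.ext (by simp [hfg])))
    (LinearMap.ext fun x => by simp)

@[simp]
theorem coe_splitKerEquiv_apply_snd (f : W →ₗ[R] V) (g : V →ₗ[R] W) (h : f ∘ₗ g = LinearMap.id)
    (x : W) : ((splitKerEquiv f g h x).2 : W) = x - g (f x) :=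
  rfl

@[simp]
theorem splitKerEquiv_symm_apply (f : W →ₗ[R] V) (g : V →ₗ[R] W) (h : f ∘ₗ g = LinearMap.id)
    (x : V × LinearMap.ker f) : (splitKerEquiv f g h).symm x = g x.1 + x.2 :=
  rfl

theorem fg_inf_ker_of_forall_apply_apply_mem {N : Submodule R W} (hN : N.FG) (f : W →ₗ[R] V)
    (g : V →ₗ[R] W) (hfg : ∀ x ∈ N, f (g (f x)) = f x) (hgf : ∀ x ∈ N, g (f x) ∈ N) :
    (N ⊓ LinearMap.ker f).FG := by
  have hmap : N.map (LinearMap.id - g ∘ₗ f) = N ⊓ LinearMap.ker f := by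
    refine le_antisymm ?_ fun x hx => ⟨x, hx.1, by simp [LinearMap.mem_ker.1 hx.2]⟩
    rintro _ ⟨x, hx, rfl⟩
    exact ⟨N.sub_mem hx (hgf x hx), by simp [hfg x hx]⟩
  exact hmap ▸ hN.map _

end Splitting

section StackedBases

variable {R E : Type*} [CommRing R] [AddCommGroup E] [Module R E] {n : ℕ}

theorem mem_span_singleton_sup_iff_mk_dvd {I : Ideal R} {a x : R} :
    x ∈ Ideal.span {a} ⊔ I ↔ Ideal.Quotient.mk I a ∣ Ideal.Quotient.mk I x := by
  rw [← Ideal.mem_quotient_iff_mem_sup, Ideal.map_span, Set.image_singleton,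
    Ideal.mem_span_singleton]

theorem apply_mem_of_mem_smul_top {J : Ideal R} {x : E} (f : E →ₗ[R] R)
    (hx : x ∈ J • (⊤ : Submodule R E)) : f x ∈ J := by
  simpa using Submodule.smul_top_le_comap_smul_top J f hx

theorem mem_smul_top_of_forall_repr_mem {ι : Type*} [Finite ι] (b : Module.Basis ι R E)
    {J : Ideal R} {x : E} (hx : ∀ i, b.repr x i ∈ J) : x ∈ J • (⊤ : Submodule R E) := by
  cases nonempty_fintype ι
  rw [← b.sum_repr x]
  exact Submodule.sum_mem _ fun i _ => Submodule.smul_mem_smul (hx i) trivial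

theorem smul_basis_mem_of_mem_iff_forall_repr_mem {ι : Type*} {b : Module.Basis ι R E}
    {P : Submodule R E} {J : ι → Ideal R} (hP : ∀ x, x ∈ P ↔ ∀ i, b.repr x i ∈ J i) {i : ι} {r : R}
    (hr : r ∈ J i) : r • b i ∈ P := by
  refine (hP _).2 fun j => ?_
  obtain rfl | hij := eq_or_ne i j
  · simpa using hr
  · simp [hij]

theorem nonempty_basis_ker_of_apply_basis_zero_eq_one (b : Module.Basis (Fin (n + 1)) R E)
    {φ : E →ₗ[R] R} (hφ : φ (b 0) = 1) :
    Nonempty (Module.Basis (Fin n) R (LinearMap.ker φ)) := by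
  let coords : LinearMap.ker φ →ₗ[R] Fin n → R :=
    LinearMap.pi fun i => b.coord i.succ ∘ₗ (LinearMap.ker φ).subtype
  refine ⟨.ofEquivFun (.ofBijective coords ⟨?_, fun y => ?_⟩)⟩
  · refine (injective_iff_map_eq_zero coords).2 fun x hx => Subtype.ext ?_
    have hx0 : (x : E) = b.repr x 0 • b 0 := by
      conv_lhs => rw [← b.sum_repr x, Fin.sum_univ_succ]
      rw [add_eq_left]
      refine Finset.sum_eq_zero fun i _ => ?_
      rw [show b.repr x i.succ = 0 from congr_fun hx i, zero_smul]
    have h : b.repr x 0 = 0 := by simpa [hφ] using (congr_arg φ hx0).symm.trans x.2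
    simpa [h] using hx0
  · let v := ∑ i, y i • b i.succ
    have hv : v - φ v • b 0 ∈ LinearMap.ker φ := by simp [hφ]
    refine ⟨⟨_, hv⟩, funext fun i => ?_⟩
    simp [coords, v, Finsupp.single_apply]

variable {I : Ideal R} {P : Submodule R E}

theorem exists_linearMap_apply_eq_one_and_smul_mem (hI : IsDvdTotalUpToIdempotent (R ⧸ I))
    (b : Module.Basis (Fin (n + 1)) R E) (hP : P.FG) (hIP : I • ⊤ ≤ P) :
    ∃ (φ : E →ₗ[R] R) (e : E) (a : R), φ (b 0) = 1 ∧ φ e = 1 ∧ a • e ∈ P ∧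
      P ≤ (Ideal.span {a} ⊔ I) • ⊤ := by
  -- Adding to `b.coord 0` a combination `g` of the other coordinates keeps the value `1` at `b 0`
  -- and makes the value at some `q ∈ P` divide, modulo `I`, all coordinates of all vectors of `P`.
  let π : (E →ₗ[R] R) →ₗ[R] E →ₗ[R] R ⧸ I := (Algebra.linearMap R (R ⧸ I)).compRight R
  let G : Submodule R (E →ₗ[R] R) := Submodule.span R (Set.range fun i : Fin n => b.coord i.succ)
  obtain ⟨_, ⟨g, hg, rfl⟩, q, hq, H⟩ := exists_mem_forall_add_apply_dvd hI
    Ideal.Quotient.mk_surjective hP ((Submodule.fg_span (Set.finite_range _)).map π : (G.map π).FG)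
    (π (b.coord 0))
  have hg0 : g (b 0) = 0 := by
    have hle : G ≤ LinearMap.ker (LinearMap.applyₗ (b 0)) :=
      Submodule.span_le.2 <| Set.range_subset_iff.2 fun i => by simp
    exact hle hg
  obtain ⟨φ, hφ⟩ : ∃ φ, φ = b.coord 0 + g := ⟨_, rfl⟩
  have hφ0 : φ (b 0) = 1 := by simp [hφ, hg0]
  have hcoord : ∀ x ∈ P, ∀ i, b.repr x i ∈ Ideal.span {φ q} ⊔ I := by
    intro x hx i
    rw [mem_span_singleton_sup_iff_mk_dvd, hφ]
    refine Fin.cases (H x hx).1 (fun i => ?_) i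
    exact (H x hx).2 _ (Submodule.mem_map_of_mem (Submodule.subset_span ⟨i, rfl⟩))
  have hPJ : P ≤ (Ideal.span {φ q} ⊔ I) • ⊤ := fun x hx =>
    mem_smul_top_of_forall_repr_mem b (hcoord x hx)
  obtain ⟨w, hw⟩ : ∃ w, q - φ q • w ∈ I • (⊤ : Submodule R E) := by
    choose w v hv hwv using fun i => Ideal.mem_span_singleton_sup.1 (hcoord q hq i)
    refine ⟨∑ i, w i • b i, mem_smul_top_of_forall_repr_mem b fun i => ?_⟩
    simpa [Finsupp.single_apply, ← hwv i, mul_comm] using hv i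
  refine ⟨φ, w + (1 - φ w) • b 0, φ q, hφ0, by simp [hφ0], ?_, hPJ⟩
  have hqw : φ q • w ∈ P := (P.sub_mem_iff_right hq).1 (hIP hw)
  have hφw : φ q * (1 - φ w) ∈ I := by
    simpa [mul_sub, mul_comm] using apply_mem_of_mem_smul_top φ hw
  rw [smul_add, smul_smul]
  exact P.add_mem hqw (hIP (Submodule.smul_mem_smul hφw trivial))

theorem mem_iff_apply_mem_and_sub_mem (hIP : I • ⊤ ≤ P) (φ : E →ₗ[R] R) {e : E} {a : R}
    (hae : a • e ∈ P) (hPa : P ≤ (Ideal.span {a} ⊔ I) • ⊤) (x : E) :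
    x ∈ P ↔ φ x ∈ Ideal.span {a} ⊔ I ∧ x - φ x • e ∈ P := by
  have smul_mem : ∀ r ∈ Ideal.span {a} ⊔ I, r • e ∈ P := by
    intro r hr
    obtain ⟨c, s, hs, rfl⟩ := Ideal.mem_span_singleton_sup.1 hr
    rw [add_smul, mul_smul]
    exact P.add_mem (P.smul_mem c hae) (hIP (Submodule.smul_mem_smul hs trivial))
  constructor
  · intro hx
    have hφx := apply_mem_of_mem_smul_top φ (hPa hx)
    exact ⟨hφx, P.sub_mem hx (smul_mem _ hφx)⟩
  · rintro ⟨hφx, hx⟩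
    exact (P.sub_mem_iff_left (smul_mem _ hφx)).1 hx

theorem le_of_mem_comap_ker_iff_forall_repr_mem {ι : Type*} {φ : E →ₗ[R] R} {e : E}
    (hφe : φ e = 1) {b : Module.Basis ι R (LinearMap.ker φ)} {J : ι → Ideal R} {J₀ : Ideal R}
    (hb : ∀ x, x ∈ P.comap (LinearMap.ker φ).subtype ↔ ∀ i, b.repr x i ∈ J i)
    (hP : P ≤ J₀ • ⊤) (i : ι) : J i ≤ J₀ := by
  let σ := splitKerEquiv φ (LinearMap.toSpanSingleton R E e) (LinearMap.ext_ring (by simp [hφe]))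
  intro r hr
  have hrb : ((r • b i : LinearMap.ker φ) : E) ∈ P :=
    smul_basis_mem_of_mem_iff_forall_repr_mem hb hr
  have hσ : (σ (b i)).2 = b i := Subtype.ext (by simp [σ])
  simpa [hσ] using apply_mem_of_mem_smul_top
    (b.coord i ∘ₗ LinearMap.snd R R (LinearMap.ker φ) ∘ₗ σ.toLinearMap) (hP hrb)

theorem exists_basis_antitone_mem_iff_forall_repr_mem (hI : IsDvdTotalUpToIdempotent (R ⧸ I))
    (b : Module.Basis (Fin n) R E) (hP : P.FG) (hIP : I • ⊤ ≤ P) :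
    ∃ (b' : Module.Basis (Fin n) R E) (a : Fin n → R),
      Antitone (fun i => Ideal.span {a i} ⊔ I) ∧
      ∀ x, x ∈ P ↔ ∀ i, b'.repr x i ∈ Ideal.span {a i} ⊔ I := by
  induction n generalizing E with
  | zero =>
    have := b.repr.toEquiv.subsingleton
    refine ⟨b, 0, fun i => i.elim0, fun x => ⟨fun _ i => i.elim0, fun _ => ?_⟩⟩
    rw [Subsingleton.elim x 0]
    exact P.zero_mem
  | succ n ih =>
    obtain ⟨φ, e, a₀, hφ0, hφe, hae, hPa⟩ := exists_linearMap_apply_eq_one_and_smul_mem hI b hP hIP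
    obtain ⟨b₀⟩ := nonempty_basis_ker_of_apply_basis_zero_eq_one b hφ0
    have hmem := mem_iff_apply_mem_and_sub_mem hIP φ hae hPa
    have hP' : (P.comap (LinearMap.ker φ).subtype).FG := by
      refine Submodule.fg_of_fg_map_injective _ (LinearMap.ker φ).injective_subtype ?_
      rw [Submodule.map_comap_subtype, inf_comm]
      exact fg_inf_ker_of_forall_apply_apply_mem hP φ (LinearMap.toSpanSingleton R E e)
        (fun x _ => by simp [hφe]) fun x hx => (P.sub_mem_iff_right hx).1 ((hmem x).1 hx).2
    have hIP' : I • ⊤ ≤ P.comap (LinearMap.ker φ).subtype :=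
      (Submodule.smul_top_le_comap_smul_top I _).trans (Submodule.comap_mono hIP)
    obtain ⟨b', a, ha, hb'⟩ := ih b₀ hP' hIP'
    have hle := le_of_mem_comap_ker_iff_forall_repr_mem hφe hb' hPa
    let σ := splitKerEquiv φ (LinearMap.toSpanSingleton R E e) (LinearMap.ext_ring (by simp [hφe]))
    refine ⟨.ofEquivFun <| σ ≪≫ₗ (LinearEquiv.refl R R).prodCongr b'.equivFun ≪≫ₗ
      Fin.consLinearEquiv R fun _ => R, Fin.cons a₀ a, fun i j hij => ?_, fun x => ?_⟩
    · cases j using Fin.cases with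
      | zero => rw [Fin.le_zero_iff.1 hij]
      | succ j =>
        cases i using Fin.cases with
        | zero => exact hle j
        | succ i => exact ha (Fin.succ_le_succ_iff.1 hij)
    · rw [hmem x, Fin.forall_fin_succ]
      exact and_congr_right fun _ => hb' (σ x).2

end StackedBases

section DeterminantalIdeal

variable {R E ι : Type*} [CommRing R] [AddCommGroup E] [Module R E]

section Basis

variable [Fintype ι] [DecidableEq ι]

/-- The ideal generated by the determinants of the families of vectors of `P` with respect to a
basis `b`, the intrinsic form of the determinantal ideal of maximal order: `P` stands for the column
module of a matrix. -/
def detIdeal (b : Module.Basis ι R E) (P : Submodule R E) : Ideal R :=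
  Ideal.span {d | ∃ v : ι → E, (∀ i, v i ∈ P) ∧ b.det v = d}

variable {P : Submodule R E}

theorem det_mem_detIdeal (b : Module.Basis ι R E) {v : ι → E} (hv : ∀ i, v i ∈ P) :
    b.det v ∈ detIdeal b P :=
  Ideal.subset_span ⟨v, hv, rfl⟩

theorem detIdeal_le_iff {b : Module.Basis ι R E} {I : Ideal R} :
    detIdeal b P ≤ I ↔ ∀ v : ι → E, (∀ i, v i ∈ P) → b.det v ∈ I := by
  refine ⟨fun h v hv => h (det_mem_detIdeal b hv), fun h => Ideal.span_le.2 ?_⟩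
  rintro _ ⟨v, hv, rfl⟩
  exact h v hv

theorem detIdeal_eq_detIdeal (b b' : Module.Basis ι R E) : detIdeal b P = detIdeal b' P := by
  suffices h : ∀ b b' : Module.Basis ι R E, detIdeal b P ≤ detIdeal b' P from
    le_antisymm (h b b') (h b' b)
  refine fun b b' => detIdeal_le_iff.2 fun v hv => ?_
  rw [AlternatingMap.eq_smul_basis_det b' b.det]
  exact Ideal.mul_mem_left _ _ (det_mem_detIdeal b' hv)

open scoped Pointwise in
theorem detIdeal_eq_prod {b : Module.Basis ι R E} {J : ι → Ideal R}
    (hP : ∀ x, x ∈ P ↔ ∀ i, b.repr x i ∈ J i) : detIdeal b P = ∏ i, J i := by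
  refine le_antisymm (detIdeal_le_iff.2 fun v hv => ?_) ?_
  · rw [Module.Basis.det_apply, Matrix.det_apply]
    refine Ideal.sum_mem _ fun σ _ => Submodule.smul_of_tower_mem _ _ ?_
    rw [← Equiv.prod_comp σ J]
    exact Ideal.prod_mem_prod fun i _ => (hP (v i)).1 (hv i) (σ i)
  · have hJ : ∏ i, J i = Ideal.span (∏ i, (J i : Set R)) := by
      rw [← Ideal.prod_span]
      simp only [Ideal.span_eq]
    rw [hJ, Ideal.span_le]
    intro d hd
    obtain ⟨r, hr, rfl⟩ := (Set.mem_fintype_prod _ _).1 hd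
    have hdet : b.det (fun i => r i • b i) = ∏ i, r i := by
      rw [b.det.map_smul_univ r b, b.det_self, smul_eq_mul, mul_one]
    rw [← hdet]
    exact det_mem_detIdeal b fun i => smul_basis_mem_of_mem_iff_forall_repr_mem hP (hr i)

theorem smul_mem_of_mem_detIdeal {b : Module.Basis ι R E} {d : R} (hd : d ∈ detIdeal b P) (x : E) :
    d • x ∈ P := by
  suffices h : detIdeal b P ≤ P.comap (LinearMap.toSpanSingleton R E x) from h hd
  refine detIdeal_le_iff.2 fun v hv => ?_
  have cramer : b.det v • x = ∑ i, (b.toMatrix v).cramer (b.repr x) i • v i := by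
    refine b.ext_elem fun i => ?_
    have := congr_fun (Matrix.mulVec_cramer (b.toMatrix v) (b.repr x)) i
    simpa [b.det_apply, Matrix.mulVec, dotProduct, b.toMatrix_apply, mul_comm] using this.symm
  rw [Submodule.mem_comap, LinearMap.toSpanSingleton_apply, cramer]
  exact P.sum_mem fun i _ => P.smul_mem _ (hv i)

end Basis

theorem alternatingMap_apply_mem_span_range [LinearOrder ι] {n : ℕ} (f : E [⋀^Fin n]→ₗ[R] R)
    (c : ι → E) {v : Fin n → E} (hv : ∀ i, v i ∈ Submodule.span R (Set.range c)) :
    f v ∈ Ideal.span (Set.range fun g : Fin n ↪o ι => f (c ∘ g)) := by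
  let N := Submodule.span R (Set.range c)
  let c' : ι → N := fun j => ⟨c j, Submodule.subset_span ⟨j, rfl⟩⟩
  have hc' : Submodule.span R (Set.range c') = ⊤ :=
    (Submodule.span_range_subtype_eq_top_iff N fun j => Submodule.subset_span ⟨j, rfl⟩).2 rfl
  let F := exteriorPower.alternatingMapLinearEquiv (f.compLinearMap N.subtype)
  have hF : (⊤ : Submodule R (⋀[R]^n N)).map F ≤
      Ideal.span (Set.range fun g : Fin n ↪o ι => f (c ∘ g)) := by
    rw [← exteriorPower.ιMulti_family_span_of_span R hc', Submodule.map_span_le]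
    rintro _ ⟨s, rfl⟩
    refine Ideal.subset_span ⟨Set.powersetCard.ofFinEmbEquiv.symm s, ?_⟩
    exact (exteriorPower.alternatingMapLinearEquiv_apply_ιMulti
      (f.compLinearMap N.subtype) (c' ∘ Set.powersetCard.ofFinEmbEquiv.symm s)).symm
  have hFv : F (exteriorPower.ιMulti R n fun i => ⟨v i, hv i⟩) = f v :=
    exteriorPower.alternatingMapLinearEquiv_apply_ιMulti _ _
  rw [← hFv]
  exact hF (Submodule.mem_map_of_mem trivial)

theorem determinantalIdeal_eq_detIdeal {n m : ℕ} (M : Matrix (Fin n) (Fin m) R) :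
    M.determinantalIdeal n = detIdeal (Pi.basisFun R (Fin n)) (LinearMap.range M.mulVecLin) := by
  have h : ∀ p : (Fin n ↪o Fin n) × (Fin n ↪o Fin m),
    (Pi.basisFun R (Fin n)).det (M.col ∘ p.2) = (M.submatrix p.1 p.2).det := by
    intro p
    have hp : ⇑p.1 = id := (StrictMono.range_inj p.1.strictMono strictMono_id).1 <| by
      rw [Set.range_id, (Finite.injective_iff_surjective.1 p.1.injective).range_eq]
    rw [hp, Pi.basisFun_det_apply, ← Matrix.det_transpose]
    rfl
  rw [Matrix.range_mulVecLin]
  refine le_antisymm (Ideal.span_le.2 ?_) (detIdeal_le_iff.2 fun v hv => ?_)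
  · rintro _ ⟨p, rfl⟩
    simp only [← h]
    exact det_mem_detIdeal _ fun i => Submodule.subset_span ⟨p.2 i, rfl⟩
  · refine Ideal.span_mono ?_ (alternatingMap_apply_mem_span_range _ M.col hv)
    rintro _ ⟨g, rfl⟩
    exact ⟨(RelEmbedding.refl _, g), (h (RelEmbedding.refl _, g)).symm⟩

theorem le_of_determinantalIdeal_ne_bot {n m : ℕ} {M : Matrix (Fin n) (Fin m) R}
    (hM : M.determinantalIdeal n ≠ ⊥) : n ≤ m := by
  contrapose! hM
  refine Ideal.span_eq_bot.2 ?_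
  rintro _ ⟨⟨_, g⟩, rfl⟩
  exact absurd (by simpa using Fintype.card_le_of_injective g g.injective) hM.not_ge

end DeterminantalIdeal

section InvertibleIdeals

variable {R K : Type*} [CommRing R] [IsPruferDomain R] [Field K] [Algebra R K] [IsFractionRing R K]

variable (K) in
theorem IsPruferDomain.isUnit_coeIdeal {I : Ideal R} (hI : I.FG) (h0 : I ≠ ⊥) :
    IsUnit (I : FractionalIdeal R⁰ K) := by
  obtain ⟨J, -, c, hc, hJ⟩ := IsPruferDomain.exists_mul_eq_span_singleton I hI h0
  have hcK : algebraMap R K c ≠ 0 := by simpa using hc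
  refine isUnit_of_mul_isUnit_left (y := (J : FractionalIdeal R⁰ K)) ?_
  rw [← FractionalIdeal.coeIdeal_mul, hJ, FractionalIdeal.coeIdeal_span_singleton]
  exact .of_mul_eq_one _ (FractionalIdeal.spanSingleton_mul_inv K hcK)

theorem IsPruferDomain.isUnit_of_fg {F : FractionalIdeal R⁰ K} (hF : (F : Submodule R K).FG)
    (h0 : F ≠ 0) : IsUnit F := by
  obtain ⟨a, I, ha, hI⟩ := FractionalIdeal.exists_eq_spanSingleton_mul F
  have haK : algebraMap R K a ≠ 0 := by simpa using ha
  have hIF : FractionalIdeal.spanSingleton R⁰ (algebraMap R K a) * F = I := by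
    rw [hI, ← mul_assoc, FractionalIdeal.spanSingleton_mul_spanSingleton, mul_inv_cancel₀ haK,
      FractionalIdeal.spanSingleton_one, one_mul]
  have hIfg : I.FG := by
    rw [← FractionalIdeal.coeIdeal_fg R⁰ (IsFractionRing.injective R K), ← hIF,
      FractionalIdeal.coe_mul, FractionalIdeal.coe_spanSingleton]
    exact (Submodule.fg_span_singleton _).mul hF
  have hI0 : I ≠ ⊥ := by
    rintro rfl
    exact h0 (by rw [hI, FractionalIdeal.coeIdeal_bot, mul_zero])
  exact isUnit_of_mul_isUnit_right (hIF ▸ IsPruferDomain.isUnit_coeIdeal K hIfg hI0)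

theorem IsPruferDomain.exists_unit_coe_eq {N : Submodule R K} (hN : N.FG) (h0 : N ≠ ⊥) :
    ∃ u : (FractionalIdeal R⁰ K)ˣ, ((u : FractionalIdeal R⁰ K) : Submodule R K) = N := by
  obtain ⟨F, rfl⟩ : ∃ F : FractionalIdeal R⁰ K, (F : Submodule R K) = N :=
    ⟨⟨N, FractionalIdeal.isFractional_of_fg hN⟩, rfl⟩
  obtain ⟨u, rfl⟩ := IsPruferDomain.isUnit_of_fg hN (mt FractionalIdeal.coeToSubmodule_eq_bot.2 h0)
  exact ⟨u, rfl⟩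

end InvertibleIdeals

section PseudoBasis

variable {R K V W ι κ : Type*} [CommRing R] [Field K] [Algebra R K]
  [AddCommGroup W] [Module R W] [Module K W] [AddCommGroup V] [Module R V] [Module K V]

/-- A pseudo-basis of a lattice `N` in a vector space: a basis `b` and invertible fractional ideals
`𝔟 i` such that `N` is the direct sum of the `𝔟 i • b i`. -/
def IsPseudoBasis (b : Module.Basis ι K W) (𝔟 : ι → (FractionalIdeal R⁰ K)ˣ)
    (N : Submodule R W) : Prop :=
  ∀ x, x ∈ N ↔ ∀ i, b.repr x i ∈ (𝔟 i : FractionalIdeal R⁰ K)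

namespace IsPseudoBasis

variable {b : Module.Basis ι K W} {𝔟 : ι → (FractionalIdeal R⁰ K)ˣ} {N : Submodule R W}

theorem smul_mem (hb : IsPseudoBasis b 𝔟 N) {i : ι} {a : K}
    (ha : a ∈ (𝔟 i : FractionalIdeal R⁰ K)) : a • b i ∈ N := by
  refine (hb _).2 fun j => ?_
  obtain rfl | hij := eq_or_ne i j
  · simpa using ha
  · simpa [hij] using FractionalIdeal.zero_mem _

theorem reindex (hb : IsPseudoBasis b 𝔟 N) (e : ι ≃ κ) :
    IsPseudoBasis (b.reindex e) (𝔟 ∘ e.symm) N := by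
  intro x
  simp only [hb x, Module.Basis.repr_reindex_apply, Function.comp_apply,
    e.symm.surjective.forall]

theorem span_eq_top (hb : IsPseudoBasis b 𝔟 N) :
    Submodule.span K (N : Set W) = ⊤ := by
  rw [eq_top_iff, ← b.span_eq, Submodule.span_le]
  rintro _ ⟨i, rfl⟩
  obtain ⟨a, ha, ha0⟩ : ∃ a ∈ (𝔟 i : FractionalIdeal R⁰ K), a ≠ 0 := by
    by_contra! h
    exact (𝔟 i).ne_zero (FractionalIdeal.eq_zero_iff.2 h)
  exact (Submodule.smul_mem_iff _ ha0).1 (Submodule.subset_span (hb.smul_mem ha))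

theorem map_of_isLocalizedModule [IsFractionRing R K] [IsScalarTower R K W] [Finite ι]
    {E : Type*} [AddCommGroup E] [Module R E] (ℓ : E →ₗ[R] W) [IsLocalizedModule R⁰ ℓ]
    {B : Module.Basis ι R E} {J : ι → Ideal R} {P : Submodule R E}
    (hP : ∀ x, x ∈ P ↔ ∀ i, B.repr x i ∈ J i)
    (hJ : ∀ i, (𝔟 i : FractionalIdeal R⁰ K) = J i) :
    IsPseudoBasis (B.ofIsLocalizedModule K R⁰ ℓ) 𝔟 (P.map ℓ) := by
  cases nonempty_fintype ι
  intro x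
  simp only [hJ, FractionalIdeal.mem_coeIdeal]
  refine ⟨?_, fun hx => ?_⟩
  · rintro ⟨y, hy, rfl⟩ i
    exact ⟨_, (hP y).1 hy i, (B.ofIsLocalizedModule_repr_apply ..).symm⟩
  · choose r hr hrx using hx
    refine ⟨∑ i, r i • B i, (hP _).2 fun i => by rw [B.repr_sum_self]; exact hr i, ?_⟩
    refine (B.ofIsLocalizedModule K R⁰ ℓ).ext_elem fun i => ?_
    rw [B.ofIsLocalizedModule_repr_apply K R⁰ ℓ, B.repr_sum_self, hrx]

theorem nonempty_directSum_linearEquiv [IsScalarTower R K W] [Finite ι]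
    (hb : IsPseudoBasis b 𝔟 N) :
    Nonempty ((⨁ i, ((𝔟 i : FractionalIdeal R⁰ K) : Submodule R K)) ≃ₗ[R] N) := by
  classical
  cases nonempty_fintype ι
  let coords : N →ₗ[R] ∀ i, ((𝔟 i : FractionalIdeal R⁰ K) : Submodule R K) :=
    LinearMap.pi fun i => (((b.coord i).restrictScalars R).comp N.subtype).codRestrict _
      fun x => (hb x).1 x.2 i
  have hcoords : Function.Bijective coords := by
    refine ⟨fun x y hxy => Subtype.ext (b.ext_elem fun i => ?_), fun a => ?_⟩
    · exact congr_arg Subtype.val (congr_fun hxy i)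
    · have ha : ∑ i, (a i : K) • b i ∈ N := N.sum_mem fun i _ => hb.smul_mem (a i).2
      exact ⟨⟨_, ha⟩, funext fun i => Subtype.ext (congr_fun (b.repr_sum_self fun i => a i) i)⟩
  exact ⟨(DirectSum.linearEquivFunOnFintype R ι _).trans (.symm (.ofBijective coords hcoords))⟩

end IsPseudoBasis

end PseudoBasis

section PseudoBasisSplitting

variable {R K V W ι κ : Type*} [CommRing R] [Field K] [Algebra R K]
  [AddCommGroup W] [Module R W] [Module K W] [IsScalarTower R K W]
  [AddCommGroup V] [Module K V]

/-- Invertible fractional ideals are projective. -/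
theorem exists_apply_eq_and_forall_smul_mem (𝔞 : (FractionalIdeal R⁰ K)ˣ) {N : Submodule R W}
    {f : W →ₗ[K] V} {v : V} (h : ∀ a ∈ (𝔞 : FractionalIdeal R⁰ K), ∃ x ∈ N, f x = a • v) :
    ∃ w, f w = v ∧ ∀ a ∈ (𝔞 : FractionalIdeal R⁰ K), a • w ∈ N := by
  suffices key : ∀ r ∈ (𝔞 : FractionalIdeal R⁰ K) * ↑𝔞⁻¹,
      ∃ w, f w = r • v ∧ ∀ a ∈ (𝔞 : FractionalIdeal R⁰ K), a • w ∈ N by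
    simpa only [one_smul] using key 1 (𝔞.mul_inv ▸ FractionalIdeal.one_mem_one R⁰)
  refine fun r hr => FractionalIdeal.mul_induction_on hr (fun i hi j hj => ?_) ?_
  · obtain ⟨x, hx, hfx⟩ := h i hi
    refine ⟨j • x, by rw [map_smul, hfx, smul_smul, mul_comm], fun a ha => ?_⟩
    obtain ⟨s, hs⟩ : ∃ s, algebraMap R K s = a * j := by
      rw [← FractionalIdeal.mem_one_iff R⁰, ← 𝔞.mul_inv]
      exact FractionalIdeal.mul_mem_mul ha hj
    rw [smul_smul, ← hs, algebraMap_smul]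
    exact N.smul_mem s hx
  · rintro r s ⟨w, hw, hwN⟩ ⟨w', hw', hwN'⟩
    refine ⟨w + w', by rw [map_add, hw, hw', add_smul], fun a ha => ?_⟩
    rw [smul_add]
    exact N.add_mem (hwN a ha) (hwN' a ha)

theorem map_snd_splitKerEquiv_eq_comap {f : W →ₗ[K] V} {g : V →ₗ[K] W}
    (h : f ∘ₗ g = LinearMap.id) {N : Submodule R W} (hg : ∀ x ∈ N, g (f x) ∈ N) :
    N.map ((LinearMap.snd K V _ ∘ₗ (splitKerEquiv f g h).toLinearMap).restrictScalars R) =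
      N.comap ((LinearMap.ker f).subtype.restrictScalars R) := by
  ext y
  refine ⟨?_, fun hy => ⟨y, hy, Subtype.ext ?_⟩⟩
  · rintro ⟨x, hx, rfl⟩
    exact N.sub_mem hx (hg x hx)
  · simp

theorem fg_comap_ker_subtype {f : W →ₗ[K] V} {g : V →ₗ[K] W} (h : f ∘ₗ g = LinearMap.id)
    {N : Submodule R W} (hg : ∀ x ∈ N, g (f x) ∈ N) (hN : N.FG) :
    (N.comap ((LinearMap.ker f).subtype.restrictScalars R)).FG :=
  map_snd_splitKerEquiv_eq_comap h hg ▸ hN.map _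

theorem span_comap_ker_subtype_eq_top {f : W →ₗ[K] V} {g : V →ₗ[K] W}
    (h : f ∘ₗ g = LinearMap.id) {N : Submodule R W} (hg : ∀ x ∈ N, g (f x) ∈ N)
    (hN : Submodule.span K (N : Set W) = ⊤) :
    Submodule.span K (N.comap ((LinearMap.ker f).subtype.restrictScalars R) :
      Set (LinearMap.ker f)) = ⊤ := by
  rw [← map_snd_splitKerEquiv_eq_comap h hg, Submodule.map_coe, LinearMap.coe_restrictScalars,
    ← Submodule.map_span, hN, Submodule.map_top, LinearMap.range_eq_top]
  exact (LinearMap.snd_surjective (R := K)).comp (splitKerEquiv f g h).surjective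

theorem finrank_eq_card_add_finrank_ker [Module.Finite K W] [Fintype ι] {f : W →ₗ[K] V}
    {g : V →ₗ[K] W} (h : f ∘ₗ g = LinearMap.id) (c : Module.Basis ι K V) :
    Module.finrank K W = Fintype.card ι + Module.finrank K (LinearMap.ker f) := by
  have := Module.Finite.of_basis c
  rw [(splitKerEquiv f g h).finrank_eq, Module.finrank_prod, Module.finrank_eq_card_basis c]

variable [Module R V] [IsScalarTower R K V]

namespace IsPseudoBasis

variable {f : W →ₗ[K] V} {N : Submodule R W}
  {c : Module.Basis ι K V} {𝔞 : ι → (FractionalIdeal R⁰ K)ˣ}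

theorem exists_section [Finite ι] (hc : IsPseudoBasis c 𝔞 (N.map (f.restrictScalars R))) :
    ∃ g : V →ₗ[K] W, f ∘ₗ g = LinearMap.id ∧ ∀ x ∈ N, g (f x) ∈ N := by
  cases nonempty_fintype ι
  choose w hfw hwN using fun i =>
    exists_apply_eq_and_forall_smul_mem (𝔞 i) fun a ha => hc.smul_mem (i := i) ha
  refine ⟨c.constr K w, c.ext fun i => ?_, fun x hx => ?_⟩
  · rw [LinearMap.comp_apply, c.constr_basis, hfw, LinearMap.id_apply]
  · rw [c.constr_apply_fintype K]
    exact N.sum_mem fun i _ => hwN i _ ((hc (f x)).1 ⟨x, hx, rfl⟩ i)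

theorem exists_sumElim {g : V →ₗ[K] W} (h : f ∘ₗ g = LinearMap.id) (hg : ∀ x ∈ N, g (f x) ∈ N)
    (hc : IsPseudoBasis c 𝔞 (N.map (f.restrictScalars R)))
    {d : Module.Basis κ K (LinearMap.ker f)} {𝔟 : κ → (FractionalIdeal R⁰ K)ˣ}
    (hd : IsPseudoBasis d 𝔟 (N.comap ((LinearMap.ker f).subtype.restrictScalars R))) :
    ∃ b : Module.Basis (ι ⊕ κ) K W, IsPseudoBasis b (Sum.elim 𝔞 𝔟) N ∧
      ∀ s, f (b s) = Sum.elim c 0 s := by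
  let σ := splitKerEquiv f g h
  refine ⟨(c.prod d).map σ.symm, fun x => ?_, ?_⟩
  · have hx : x ∈ N ↔ f x ∈ N.map (f.restrictScalars R) ∧ (σ x).2.1 ∈ N := by
      refine ⟨fun hx => ⟨⟨x, hx, rfl⟩, N.sub_mem hx (hg x hx)⟩, ?_⟩
      rintro ⟨⟨y, hy, hyx⟩, hx⟩
      have hsum := N.add_mem hx (hg y hy)
      rwa [show f y = f x from hyx, coe_splitKerEquiv_apply_snd, sub_add_cancel] at hsum
    rw [hx, hc, Sum.forall]
    exact and_congr Iff.rfl (hd (σ x).2)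
  · rintro (i | j)
    · simpa [σ] using LinearMap.congr_fun h (c i)
    · simp [σ]

end IsPseudoBasis

theorem exists_isPseudoBasis [IsPruferDomain R] [IsFractionRing R K] [Module.Finite K W] {d : ℕ}
    (hd : Module.finrank K W = d) {N : Submodule R W} (hN : N.FG)
    (hspan : Submodule.span K (N : Set W) = ⊤) :
    ∃ (b : Module.Basis (Fin d) K W) (𝔟 : Fin d → (FractionalIdeal R⁰ K)ˣ),
      IsPseudoBasis b 𝔟 N := by
  induction d generalizing W with
  | zero =>
    have : Subsingleton W := Module.finrank_zero_iff.1 hd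
    exact ⟨Module.finBasisOfFinrankEq K W hd, 1, fun x => by simp [Subsingleton.elim x 0]⟩
  | succ d ih =>
    have : Nontrivial W := Module.nontrivial_of_finrank_eq_succ hd
    obtain ⟨w, hw⟩ := exists_ne (0 : W)
    obtain ⟨f, hf⟩ := Module.Projective.exists_dual_ne_zero K hw
    have hmap : N.map (f.restrictScalars R) ≠ ⊥ := by
      intro h
      have hker : Submodule.span K (N : Set W) ≤ LinearMap.ker f :=
        Submodule.span_le.2 fun x hx => (Submodule.eq_bot_iff _).1 h _ ⟨x, hx, rfl⟩
      exact hf (hker (hspan ▸ Submodule.mem_top))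
    obtain ⟨𝔞, h𝔞⟩ := IsPruferDomain.exists_unit_coe_eq (hN.map (f.restrictScalars R)) hmap
    have hc : IsPseudoBasis (Module.Basis.singleton (Fin 1) K) (fun _ => 𝔞)
        (N.map (f.restrictScalars R)) := fun x => by
      simp [← h𝔞]
    obtain ⟨g, hfg, hg⟩ := hc.exists_section
    have hker : Module.finrank K (LinearMap.ker f) = d := by
      have := finrank_eq_card_add_finrank_ker hfg (Module.Basis.singleton (Fin 1) K)
      rw [Fintype.card_fin] at this
      omega
    obtain ⟨b, 𝔟, hb⟩ := ih hker (fg_comap_ker_subtype hfg hg hN)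
      (span_comap_ker_subtype_eq_top hfg hg hspan)
    obtain ⟨b', hb', -⟩ := hc.exists_sumElim hfg hg hb
    exact ⟨_, _, hb'.reindex (finSumFinEquiv.trans (finCongr (add_comm 1 d)))⟩

theorem IsPseudoBasis.exists_extension [IsPruferDomain R] [IsFractionRing R K] [Module.Finite K W]
    [Fintype ι] {d : ℕ} (hd : Module.finrank K W = Fintype.card ι + d) {f : W →ₗ[K] V}
    {N : Submodule R W} (hN : N.FG) (hspan : Submodule.span K (N : Set W) = ⊤)
    {c : Module.Basis ι K V} {𝔞 : ι → (FractionalIdeal R⁰ K)ˣ}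
    (hc : IsPseudoBasis c 𝔞 (N.map (f.restrictScalars R))) :
    ∃ (b : Module.Basis (ι ⊕ Fin d) K W) (𝔟 : Fin d → (FractionalIdeal R⁰ K)ˣ),
      IsPseudoBasis b (Sum.elim 𝔞 𝔟) N ∧ ∀ s, f (b s) = Sum.elim c 0 s := by
  obtain ⟨g, hfg, hg⟩ := hc.exists_section
  have hker : Module.finrank K (LinearMap.ker f) = d := by
    have := finrank_eq_card_add_finrank_ker hfg c
    omega
  obtain ⟨e, 𝔟, he⟩ := exists_isPseudoBasis hker (fg_comap_ker_subtype hfg hg hN)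
    (span_comap_ker_subtype_eq_top hfg hg hspan)
  obtain ⟨b, hb, hfb⟩ := hc.exists_sumElim hfg hg he
  exact ⟨b, 𝔟, hb, hfb⟩

end PseudoBasisSplitting

namespace PseudoMatrix

variable {R K V W X ι κ μ : Type*} [CommRing R] [Field K] [Algebra R K]
  [Fintype ι] [DecidableEq ι]
  [AddCommGroup V] [Module R V] [Module K V] [AddCommGroup W] [Module R W] [Module K W]
  [AddCommGroup X] [Module R X] [Module K X]
  {N : Submodule R V} {P : Submodule R W} {Q : Submodule R X}
  {b b' : Module.Basis ι K V} {c c' : Module.Basis κ K W} {d : Module.Basis μ K X}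
  {𝔟 𝔟' : ι → (FractionalIdeal R⁰ K)ˣ} {𝔠 𝔠' : κ → (FractionalIdeal R⁰ K)ˣ}
  {𝔡 : μ → (FractionalIdeal R⁰ K)ˣ}

/-- The pseudo-matrix, with respect to pseudo-bases of the lattices `N` and `P`, of a linear map
that sends `N` into `P`. -/
noncomputable def ofLinearMap [Finite κ] (f : V →ₗ[K] W) (hf : ∀ x ∈ N, f x ∈ P)
    (hb : IsPseudoBasis b 𝔟 N) (hc : IsPseudoBasis c 𝔠 P) : PseudoMatrix 𝔠 𝔟 where
  mat := LinearMap.toMatrix b c f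
  mul_mem i j x hx := by
    have hmem := (hc _).1 (hf _ (hb.smul_mem hx)) i
    rwa [map_smul, map_smul, Finsupp.smul_apply, smul_eq_mul,
      mul_comm, ← LinearMap.toMatrix_apply] at hmem

variable [Fintype κ] [DecidableEq κ]

theorem ofLinearMap_mul_ofLinearMap [Finite μ] {f : V →ₗ[K] W} {g : W →ₗ[K] X}
    (hf : ∀ x ∈ N, f x ∈ P) (hg : ∀ y ∈ P, g y ∈ Q)
    (hb : IsPseudoBasis b 𝔟 N) (hc : IsPseudoBasis c 𝔠 P) (hd : IsPseudoBasis d 𝔡 Q) :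
    (ofLinearMap g hg hc hd).mul (ofLinearMap f hf hb hc) =
      ofLinearMap (g ∘ₗ f) (fun x hx => hg _ (hf x hx)) hb hd :=
  PseudoMatrix.ext (LinearMap.toMatrix_comp b c d g f).symm

theorem ofLinearMap_id (hb : IsPseudoBasis b 𝔟 N) :
    ofLinearMap LinearMap.id (fun _ hx => hx) hb hb = one 𝔟 :=
  PseudoMatrix.ext (LinearMap.toMatrix_id b)

theorem isInvertible_ofLinearMap_id (hb : IsPseudoBasis b 𝔟 N) (hb' : IsPseudoBasis b' 𝔟' N) :
    (ofLinearMap LinearMap.id (fun _ hx => hx) hb hb').IsInvertible :=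
  ⟨ofLinearMap LinearMap.id (fun _ hx => hx) hb' hb, by
    simp only [ofLinearMap_mul_ofLinearMap, LinearMap.id_comp, ofLinearMap_id, and_self]⟩

theorem equivalent_ofLinearMap {f : V →ₗ[K] W} (hf : ∀ x ∈ N, f x ∈ P)
    (hb : IsPseudoBasis b 𝔟 N) (hb' : IsPseudoBasis b' 𝔟' N)
    (hc : IsPseudoBasis c 𝔠 P) (hc' : IsPseudoBasis c' 𝔠' P) :
    (ofLinearMap f hf hb hc).Equivalent (ofLinearMap f hf hb' hc') :=
  ⟨ofLinearMap LinearMap.id (fun _ hx => hx) hc hc',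
    ofLinearMap LinearMap.id (fun _ hx => hx) hb' hb,
    isInvertible_ofLinearMap_id hc hc', isInvertible_ofLinearMap_id hb' hb, by
    simp only [ofLinearMap_mul_ofLinearMap, LinearMap.id_comp, LinearMap.comp_id]⟩

end PseudoMatrix

section StandardLattice

variable {R K ι : Type*} [CommRing R] [Field K] [Algebra R K]

variable (R K ι) in
/-- The inclusion of the standard lattice `R^ι` into the vector space `K^ι`. -/
abbrev standardLatticeInclusion : (ι → R) →ₗ[R] ι → K :=
  LinearMap.pi fun i => Algebra.linearMap R K ∘ₗ LinearMap.proj i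

theorem isPseudoBasis_range_standardLatticeInclusion [IsFractionRing R K] [Finite ι]
    (B : Module.Basis ι R (ι → R)) :
    IsPseudoBasis (B.ofIsLocalizedModule K R⁰ (standardLatticeInclusion R K ι)) (fun _ => 1)
      (LinearMap.range (standardLatticeInclusion R K ι)) := by
  rw [← Submodule.map_top]
  exact IsPseudoBasis.map_of_isLocalizedModule _ (J := fun _ => ⊤) (by simp) (by simp)

theorem isPseudoBasis_basisFun [IsFractionRing R K] [Finite ι] :
    IsPseudoBasis (Pi.basisFun K ι) (fun _ => 1)
      (LinearMap.range (standardLatticeInclusion R K ι)) := by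
  classical
  have hbasis : (Pi.basisFun R ι).ofIsLocalizedModule K R⁰ (standardLatticeInclusion R K ι) =
      Pi.basisFun K ι := by
    refine Module.Basis.eq_of_apply_eq fun i => ?_
    ext j
    simp [Module.Basis.ofIsLocalizedModule_apply, Pi.single_apply]
  exact hbasis ▸ isPseudoBasis_range_standardLatticeInclusion (Pi.basisFun R ι)

variable [Fintype ι] [DecidableEq ι] {κ : Type*}

theorem toLin'_map_apply_standardLatticeInclusion (M : Matrix κ ι R) (x : ι → R) :
    Matrix.toLin' (M.map (algebraMap R K)) (standardLatticeInclusion R K ι x) =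
      standardLatticeInclusion R K κ (M.mulVecLin x) :=
  funext fun i => ((algebraMap R K).map_mulVec M x i).symm

theorem toLin'_map_mem_range_standardLatticeInclusion (M : Matrix κ ι R) :
    ∀ x ∈ LinearMap.range (standardLatticeInclusion R K ι),
      Matrix.toLin' (M.map (algebraMap R K)) x ∈
        LinearMap.range (standardLatticeInclusion R K κ) := by
  rintro _ ⟨x, rfl⟩
  exact ⟨_, (toLin'_map_apply_standardLatticeInclusion M x).symm⟩

theorem map_toLin'_range_standardLatticeInclusion (M : Matrix κ ι R) :
    (LinearMap.range (standardLatticeInclusion R K ι)).map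
        ((Matrix.toLin' (M.map (algebraMap R K))).restrictScalars R) =
      (LinearMap.range M.mulVecLin).map (standardLatticeInclusion R K κ) := by
  rw [← LinearMap.range_comp, ← LinearMap.range_comp]
  exact congr_arg _ (LinearMap.ext (toLin'_map_apply_standardLatticeInclusion M))

theorem PseudoMatrix.ofMatrix_eq_ofLinearMap [IsFractionRing R K] [Finite κ] (M : Matrix κ ι R) :
    PseudoMatrix.ofMatrix M = PseudoMatrix.ofLinearMap (Matrix.toLin' (M.map (algebraMap R K)))
      (toLin'_map_mem_range_standardLatticeInclusion M)
      isPseudoBasis_basisFun isPseudoBasis_basisFun :=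
  PseudoMatrix.ext (LinearMap.toMatrix'_toLin' _).symm

end StandardLattice

section InvariantFactors

variable {R K : Type*} [CommRing R] [Field K] [Algebra R K] [IsFractionRing R K]

theorem krullDimLE_zero_quotient_of_ne_bot [Ring.DimensionLEOne R] {I : Ideal R} (hI : I ≠ ⊥) :
    Ring.KrullDimLE 0 (R ⧸ I) :=
  Ideal.krullDimLE_zero_quotient_iff_forall_minimalPrimes_isMaximal.2 fun _ hJ =>
    hJ.1.1.isMaximal (ne_bot_of_le_ne_bot hI hJ.1.2)

theorem exists_basis_antitone_prod_eq_detIdeal [IsPruferDomain R] {E : Type*} [AddCommGroup E]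
    [Module R E] {n : ℕ} (b : Module.Basis (Fin n) R E) {P : Submodule R E} (hP : P.FG) {δ : R}
    (hδ : δ ≠ 0) (hδP : δ ∈ detIdeal b P) [Ring.KrullDimLE 0 (R ⧸ Ideal.span {δ})] :
    ∃ (B : Module.Basis (Fin n) R E) (a : Fin n → R) (𝔞 : Fin n → (FractionalIdeal R⁰ K)ˣ),
      (∀ i, (𝔞 i : FractionalIdeal R⁰ K) = (Ideal.span {a i, δ} : Ideal R)) ∧
      Antitone (fun i => (𝔞 i : FractionalIdeal R⁰ K)) ∧
      ∏ i, (𝔞 i : FractionalIdeal R⁰ K) = (detIdeal b P : Ideal R) ∧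
      ∀ x, x ∈ P ↔ ∀ i, B.repr x i ∈ Ideal.span {a i, δ} := by
  have hδE : Ideal.span {δ} • (⊤ : Submodule R E) ≤ P := by
    rw [Submodule.ideal_span_singleton_smul]
    rintro _ ⟨x, -, rfl⟩
    exact smul_mem_of_mem_detIdeal hδP x
  obtain ⟨B, a, hanti, hB⟩ := exists_basis_antitone_mem_iff_forall_repr_mem
    (isDvdTotalUpToIdempotent_quotient _) b hP hδE
  simp only [← Ideal.span_insert] at hanti hB
  choose 𝔞 h𝔞 using fun i => IsPruferDomain.isUnit_coeIdeal K (I := Ideal.span {a i, δ})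
    (Submodule.fg_span (Set.toFinite _))
    ((Submodule.ne_bot_iff _).2 ⟨δ, Ideal.subset_span (by simp), hδ⟩)
  refine ⟨B, a, 𝔞, h𝔞, ?_, ?_, hB⟩
  · intro i j hij
    simpa only [h𝔞] using (FractionalIdeal.coeIdeal_le_coeIdeal K).2 (hanti hij)
  · rw [detIdeal_eq_detIdeal b B, detIdeal_eq_prod hB]
    simp only [h𝔞]
    exact (map_prod (FractionalIdeal.coeIdealHom R⁰ K) _ _).symm

end InvariantFactors

section NormalForm

variable {R K : Type*} [CommRing R] [Field K] [Algebra R K] {n d : ℕ}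

theorem toMatrix_reindex_finSumFinEquiv {V W : Type*} [AddCommGroup V] [Module K V]
    [AddCommGroup W] [Module K W] {f : W →ₗ[K] V} {b : Module.Basis (Fin n ⊕ Fin d) K W}
    {c : Module.Basis (Fin n) K V} (h : ∀ s, f (b s) = Sum.elim c 0 s) :
    LinearMap.toMatrix (b.reindex finSumFinEquiv) c f =
      Matrix.of fun (i : Fin n) (j : Fin (n + d)) => if (i : ℕ) = (j : ℕ) then 1 else 0 := by
  ext i j
  refine j.addCases (fun j => ?_) fun j => ?_
  · simp [LinearMap.toMatrix_apply, h, Finsupp.single_apply, Fin.ext_iff, eq_comm]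
  · simp [LinearMap.toMatrix_apply, h, (i.is_lt.trans_le (Nat.le_add_right n j)).ne]

theorem exists_equivalent_ofMatrix [IsPruferDomain R] [IsFractionRing R K]
    (M : Matrix (Fin n) (Fin (n + d)) R) {B : Module.Basis (Fin n) R (Fin n → R)}
    {𝔞 : Fin n → (FractionalIdeal R⁰ K)ˣ}
    (hB : IsPseudoBasis (B.ofIsLocalizedModule K R⁰ (standardLatticeInclusion R K (Fin n))) 𝔞
      ((LinearMap.range M.mulVecLin).map (standardLatticeInclusion R K (Fin n)))) :
    ∃ (𝔟 : Fin d → (FractionalIdeal R⁰ K)ˣ)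
      (M₁ : PseudoMatrix (fun _ : Fin n => (1 : (FractionalIdeal R⁰ K)ˣ)) (Fin.append 𝔞 𝔟)),
      M₁.mat = Matrix.of (fun (i : Fin n) (j : Fin (n + d)) => if (i : ℕ) = (j : ℕ) then 1 else 0) ∧
      PseudoMatrix.Equivalent (PseudoMatrix.ofMatrix M) M₁ ∧
      Nonempty ((⨁ k, (((Fin.append 𝔞 𝔟 k : (FractionalIdeal R⁰ K)ˣ) : FractionalIdeal R⁰ K) :
        Submodule R K)) ≃ₗ[R] (Fin (n + d) → R)) := by
  let ℓ := standardLatticeInclusion R K (Fin (n + d))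
  rw [← map_toLin'_range_standardLatticeInclusion] at hB
  obtain ⟨b, 𝔟, hb, hMb⟩ := hB.exists_extension (d := d) (by simp)
    (Module.Finite.iff_fg.1 inferInstance) isPseudoBasis_basisFun.span_eq_top
  have happend : Sum.elim 𝔞 𝔟 ∘ finSumFinEquiv.symm = Fin.append 𝔞 𝔟 :=
    funext (Fin.addCases (by simp) (by simp))
  have hb' := happend ▸ hb.reindex finSumFinEquiv
  have hℓ : Function.Injective ℓ := fun x y hxy =>
    funext fun i => IsFractionRing.injective R K (congr_fun hxy i)
  obtain ⟨e⟩ := hb'.nonempty_directSum_linearEquiv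
  refine ⟨𝔟, .ofLinearMap _ (toLin'_map_mem_range_standardLatticeInclusion M) hb'
    (isPseudoBasis_range_standardLatticeInclusion B),
    toMatrix_reindex_finSumFinEquiv hMb, ?_, ⟨e.trans (LinearEquiv.ofInjective ℓ hℓ).symm⟩⟩
  rw [PseudoMatrix.ofMatrix_eq_ofLinearMap]
  exact PseudoMatrix.equivalent_ofLinearMap _ _ _ _ _

end NormalForm

theorem mainTheorem5_general {R K : Type*} [CommRing R] [IsPruferDomain R] [Field K] [Algebra R K]
    [IsFractionRing R K] {n m : ℕ} (M : Matrix (Fin n) (Fin m) R) (δ : R) (hδ : δ ≠ 0)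
    (hδM : δ ∈ M.determinantalIdeal n) [Ring.KrullDimLE 0 (R ⧸ Ideal.span {δ})] :
    ∃ (hnm : n ≤ m) (𝔞 : Fin m → (FractionalIdeal R⁰ K)ˣ)
      (M₁ : PseudoMatrix (fun _ : Fin n => (1 : (FractionalIdeal R⁰ K)ˣ)) 𝔞),
      M₁.mat = Matrix.of (fun (i : Fin n) (j : Fin m) => if (i : ℕ) = (j : ℕ) then 1 else 0) ∧
      PseudoMatrix.Equivalent (PseudoMatrix.ofMatrix M) M₁ ∧
      Antitone (fun i : Fin n => (𝔞 (Fin.castLE hnm i) : FractionalIdeal R⁰ K)) ∧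
      ∏ i : Fin n, (𝔞 (Fin.castLE hnm i) : FractionalIdeal R⁰ K) =
        (M.determinantalIdeal n : FractionalIdeal R⁰ K) ∧
      (∀ i : Fin n, ∃ a : R, (𝔞 (Fin.castLE hnm i) : FractionalIdeal R⁰ K) =
        (Ideal.span {a, δ} : Ideal R)) ∧
      Nonempty ((⨁ k : Fin m, ((𝔞 k : FractionalIdeal R⁰ K) : Submodule R K)) ≃ₗ[R]
        (Fin m → R)) := by
  have hnm : n ≤ m := le_of_determinantalIdeal_ne_bot (Submodule.ne_bot_iff _ |>.2 ⟨δ, hδM, hδ⟩)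
  obtain ⟨d, rfl⟩ := Nat.exists_eq_add_of_le hnm
  rw [determinantalIdeal_eq_detIdeal] at hδM ⊢
  obtain ⟨B, a, 𝔞, h𝔞, hanti, hprod, hB⟩ := exists_basis_antitone_prod_eq_detIdeal (K := K) _
    (Module.Finite.iff_fg.1 (Module.Finite.range M.mulVecLin)) hδ hδM
  obtain ⟨𝔟, M₁, hM₁, hequiv, hsum⟩ := exists_equivalent_ofMatrix M
    (IsPseudoBasis.map_of_isLocalizedModule _ hB h𝔞)
  have hleft : ∀ i, Fin.append 𝔞 𝔟 (Fin.castLE hnm i) = 𝔞 i := Fin.append_left 𝔞 𝔟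
  refine ⟨hnm, Fin.append 𝔞 𝔟, M₁, hM₁, hequiv, ?_, ?_, fun i => ⟨a i, ?_⟩, hsum⟩
  · simpa only [hleft] using hanti
  · simpa only [hleft] using hprod
  · rw [hleft, h𝔞]

theorem mainTheorem5 {R K : Type*} [CommRing R] [IsPruferDomain R] [Ring.DimensionLEOne R]
    [Field K] [Algebra R K] [IsFractionRing R K] {n m : ℕ} (M : Matrix (Fin n) (Fin m) R)
    (hM : M.determinantalIdeal n ≠ ⊥) (δ : R) (hδ : δ ≠ 0) (hδM : δ ∈ M.determinantalIdeal n) :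
    ∃ (hnm : n ≤ m) (𝔞 : Fin m → (FractionalIdeal R⁰ K)ˣ)
      (M₁ : PseudoMatrix (fun _ : Fin n => (1 : (FractionalIdeal R⁰ K)ˣ)) 𝔞),
      M₁.mat = Matrix.of (fun (i : Fin n) (j : Fin m) => if (i : ℕ) = (j : ℕ) then 1 else 0) ∧
      PseudoMatrix.Equivalent (PseudoMatrix.ofMatrix M) M₁ ∧
      Antitone (fun i : Fin n => (𝔞 (Fin.castLE hnm i) : FractionalIdeal R⁰ K)) ∧
      ∏ i : Fin n, (𝔞 (Fin.castLE hnm i) : FractionalIdeal R⁰ K) =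
        (M.determinantalIdeal n : FractionalIdeal R⁰ K) ∧
      (∀ i : Fin n, ∃ a : R, (𝔞 (Fin.castLE hnm i) : FractionalIdeal R⁰ K) =
        (Ideal.span {a, δ} : Ideal R)) ∧
      Nonempty ((⨁ k : Fin m, ((𝔞 k : FractionalIdeal R⁰ K) : Submodule R K)) ≃ₗ[R]
        (Fin m → R)) := by
  have := krullDimLE_zero_quotient_of_ne_bot (mt Ideal.span_singleton_eq_bot.1 hδ)
  exact mainTheorem5_general M δ hδ hδM
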